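/- All simplicial complexes are abstract simplicial complexes; a $k$-simplex (or $k$-face) has $k+1$ vertices. Let $d\ge 2$. A locally finite simplicial complex $\Sigma$ with all simplices of dimension at most $d$ is called a \emph{triangulated $d$-manifold} if it is a mod 2 homology manifold without boundary, that is, if for every $k$ the link of each $k$-simplex has the reduced $\mathbb{Z}_2$-homology of the sphere $S^{d-k-1}$ (with $S^{-1}=\emptyset$). In particular, every triangulation of a topological $d$-manifold without boundary is one. For a simplicial complex $\Sigma$, call a $(d-2)$-simplex \emph{odd} if it is contained in an odd number of $d$-simplices of $\Sigma$, and let the \emph{odd subcomplex} $\Sigma_{odd}$ consist of all odd $(d-2)$-simplices and their faces. \textbf{Theorem.} \begin{enumerate} \item Let $\Sigma$ be a finite triangulated $d$-manifold or, more generally, any finite simplicial complex in which every $(d-1)$-simplex is contained in an even number of $d$-simplices. Then the sum modulo $2$ of all $(d-2)$-simplices of $\Sigma_{odd}$ is a cycle, and it represents the zero element of $H_{d-2}(\Sigma;\mathbb{Z}_2)$. \item Let $\Sigma$ be any finite simplicial complex (for instance, a finite triangulated $d$-manifold). Let $\sharp(\Sigma_{odd})$ be the number of $(d-2)$-simplices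 of $\Sigma_{odd}$ and $\sharp(\Sigma)$ the number of $d$-simplices of $\Sigma$. If $d\equiv 0$ or $3 \pmod 4$, then $\sharp(\Sigma_{odd})$ is even. If $d\equiv 1$ or $2\pmod 4$, then $\sharp(\Sigma_{odd})\equiv\sharp(\Sigma)\pmod 2$. \item Let $d\ge 3$, let $\Sigma$ be a (possibly infinite) triangulated $d$-manifold, and let $\tau$ be a $(d-3)$-simplex of $\Sigma$ that is contained in exactly two odd $(d-2)$-simplices $\sigma_1\ne\sigma_2$. Then no $(d-1)$-simplex of $\Sigma$ contains both $\sigma_1$ and $\sigma_2$. \end{enumerate} -/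

import Mathlib

/-! Simplicial complexes are Mathlib's `PreAbstractSimplicialComplex V`: sets of nonempty finite
subsets of `V`, closed under taking nonempty subsets.  A simplex of dimension `k` has `k + 1`
vertices. -/

/-- The quotient `Z / B` (of `Z` by `Z ∩ B`) for submodules `Z` and `B` of a module. -/
abbrev Subquotient {R M : Type*} [Ring R] [AddCommGroup M] [Module R M] (Z B : Submodule R M) :
    Type _ :=
  Z ⧸ B.submoduleOf Z

section ModTwoHomology

variable {V : Type*} [DecidableEq V]

/-- Mod 2 chains on the members of cardinality `n` of a family `F` of finite sets. -/
def modTwoChains (F : Set (Finset V)) (n : ℕ) : Submodule (ZMod 2) (Finset V →₀ ZMod 2) :=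
  Finsupp.supported (ZMod 2) (ZMod 2) {s | s ∈ F ∧ s.card = n}

open Classical in
/-- The mod 2 boundary operator of a family `F` of finite sets: a set is sent to the sum of those
of its codimension-one faces that belong to `F`. -/
noncomputable def modTwoBoundary (F : Set (Finset V)) :
    (Finset V →₀ ZMod 2) →ₗ[ZMod 2] (Finset V →₀ ZMod 2) :=
  Finsupp.linearCombination (ZMod 2) fun s : Finset V =>
    ∑ v ∈ s with s.erase v ∈ F, Finsupp.single (s.erase v) (1 : ZMod 2)

/-- Chains on sets of cardinality `n` with vanishing boundary. -/
noncomputable def modTwoCycles (F : Set (Finset V)) (n : ℕ) :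
    Submodule (ZMod 2) (Finset V →₀ ZMod 2) :=
  modTwoChains F n ⊓ LinearMap.ker (modTwoBoundary F)

/-- Boundaries of chains on sets of cardinality `n + 1`. -/
noncomputable def modTwoBoundaries (F : Set (Finset V)) (n : ℕ) :
    Submodule (ZMod 2) (Finset V →₀ ZMod 2) :=
  (modTwoChains F (n + 1)).map (modTwoBoundary F)

/-- Cycles modulo boundaries, on sets of cardinality `n` (that is, in degree `n - 1`). -/
abbrev ModTwoHomology (F : Set (Finset V)) (n : ℕ) : Type _ :=
  Subquotient (modTwoCycles F n) (modTwoBoundaries F n)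

end ModTwoHomology

namespace PreAbstractSimplicialComplex

variable {V : Type*} [DecidableEq V]

/-- The set of `k`-dimensional simplices of `K`. -/
def simplices (K : PreAbstractSimplicialComplex V) (k : ℕ) : Set (Finset V) :=
  {s | s ∈ K ∧ s.card = k + 1}

/-- The group of simplicial `k`-cycles of `K` with coefficients in `ℤ/2`. -/
noncomputable abbrev cycles (K : PreAbstractSimplicialComplex V) (k : ℕ) :
    Submodule (ZMod 2) (Finset V →₀ ZMod 2) :=
  modTwoCycles K.faces (k + 1)

/-- The simplicial homology group `H_k(K; ℤ/2)` (not reduced). -/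
abbrev Homology (K : PreAbstractSimplicialComplex V) (k : ℕ) : Type _ :=
  ModTwoHomology K.faces (k + 1)

/-- The class in `H_k(K; ℤ/2)` of a cycle. -/
noncomputable def homologyClass (K : PreAbstractSimplicialComplex V) (k : ℕ) :
    K.cycles k →ₗ[ZMod 2] K.Homology k :=
  Submodule.mkQ _

/-- The reduced homology group of `K` with coefficients in `ℤ/2` in degree `n - 1`: the homology
of the augmented chain complex, in which the empty set is a simplex of dimension `-1`. -/
abbrev ReducedHomology (K : PreAbstractSimplicialComplex V) (n : ℕ) : Type _ :=
  ModTwoHomology (insert ∅ K.faces) n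

/-- `K` has the mod 2 homology of a sphere of dimension `n - 1`: its reduced homology is `ℤ/2` in
degree `n - 1` and zero in all other degrees.  The sphere of dimension `-1` is empty. -/
def IsModTwoHomologySphere (K : PreAbstractSimplicialComplex V) (n : ℕ) : Prop :=
  Nonempty (K.ReducedHomology n ≃ₗ[ZMod 2] ZMod 2) ∧
    ∀ j : ℕ, j ≠ n → Subsingleton (K.ReducedHomology j)

/-- The link of `s` in `K`. -/
def link (K : PreAbstractSimplicialComplex V) (s : Finset V) : PreAbstractSimplicialComplex V where
  faces := {t | t.Nonempty ∧ Disjoint s t ∧ s ∪ t ∈ K}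
  isRelLowerSet_faces := by
    rintro t ⟨hne, hd, hK⟩
    refine ⟨hne, fun u hu hune => ⟨hune, Finset.disjoint_of_subset_right hu hd, ?_⟩⟩
    exact (K.isRelLowerSet_faces hK).2 (Finset.union_subset_union_right hu)
      (hune.mono Finset.subset_union_right)

/-- `K` is a triangulated `d`-manifold without boundary, in the broad sense of a mod 2 homology
manifold (every triangulation of a topological `d`-manifold without boundary is one): it is locally finite, all simplices have dimension at most `d`, and the link of every simplex of
dimension `k` has the mod 2 homology of a sphere of dimension `d - k - 1`.  A simplex `s` has
dimension `s.card - 1`, so the sphere has dimension `(d + 1 - s.card) - 1`. -/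
structure IsHomologyManifold (K : PreAbstractSimplicialComplex V) (d : ℕ) : Prop where
  locallyFinite : ∀ s ∈ K, {t | t ∈ K ∧ s ⊆ t}.Finite
  card_le : ∀ s ∈ K, s.card ≤ d + 1
  link_sphere : ∀ s ∈ K, (K.link s).IsModTwoHomologySphere (d + 1 - s.card)

/-- The number of `k`-simplices of `K` that contain `s`. -/
noncomputable def incidence (K : PreAbstractSimplicialComplex V) (k : ℕ) (s : Finset V) : ℕ :=
  {t | t ∈ K.simplices k ∧ s ⊆ t}.ncard

/-- The odd subcomplex of a `d`-dimensional complex (`2 ≤ d`): the subcomplex formed by the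
`(d - 2)`-simplices that lie in an odd number of `d`-simplices, together with their faces. -/
def oddSubcomplex (K : PreAbstractSimplicialComplex V) (d : ℕ) :
    PreAbstractSimplicialComplex V where
  faces := {t | t.Nonempty ∧ ∃ s ∈ K.simplices (d - 2), Odd (K.incidence d s) ∧ t ⊆ s}
  isRelLowerSet_faces := by
    rintro t ⟨hne, s, hs, ho, hts⟩
    exact ⟨hne, fun u hu hune => ⟨hune, s, hs, ho, hu.trans hts⟩⟩

/-- The mod 2 sum of all `k`-simplices of a finite complex. -/
noncomputable def fundamentalChain (K : PreAbstractSimplicialComplex V) (k : ℕ) :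
    Finset V →₀ ZMod 2 :=
  ∑ᶠ s ∈ K.simplices k, Finsupp.single s 1

/-- The mod 2 sum of all `(d - 2)`-simplices of the odd subcomplex of `K` is a cycle, and its class
in `H_{d-2}(K; ℤ/2)` is zero. -/
def OddClassVanishes (K : PreAbstractSimplicialComplex V) (d : ℕ) : Prop :=
  ∃ h : (K.oddSubcomplex d).fundamentalChain (d - 2) ∈ K.cycles (d - 2),
    K.homologyClass (d - 2) ⟨_, h⟩ = 0

end PreAbstractSimplicialComplex

/-! Part 1. Order the vertices and let `h` send a simplex to the sum of the facets obtained by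
deleting a vertex with an even number of predecessors. Mod 2, `∂h + h∂` is the sum of all
codimension-two faces (`modTwoBoundary_evenFaces_add`). On the sum `z` of all `d`-simplices, a cycle
by the evenness hypothesis, this operator returns exactly the odd `(d-2)`-simplices. So the odd
chain is `∂(h z)`.

Part 2. Counting pairs of a `(d-2)`-simplex inside a `d`-simplex gives `♯(Σ)` times `(d+1).choose
2`; mod 2 only the odd simplices contribute.

Part 3. In the link of `τ`, every edge lies in two triangles, `H_1` vanishes, and exactly two
vertices `a`, `b` have odd degree. If `ab` were an edge, the sum of all other edges would be a
cycle, hence the boundary of a set `B` of triangles. Counting edge-triangle pairs, over all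
triangles and over `B`, gives contradictory residues of the number of edges mod 3
(`odd_vertices_not_adjacent`). -/

section Boundary

variable {V : Type*} [DecidableEq V]

/-! ### Boundary coefficients mod 2 -/

open Classical in
theorem modTwoBoundary_single (F : Set (Finset V)) (s : Finset V) :
    modTwoBoundary F (Finsupp.single s 1) =
      ∑ v ∈ s, (if s.erase v ∈ F then (1 : ZMod 2) else 0) • Finsupp.single (s.erase v) 1 := by
  rw [modTwoBoundary, Finsupp.linearCombination_single, one_smul, Finset.sum_filter]
  exact Finset.sum_congr rfl fun v _ => by split_ifs <;> simp

theorem Finset.exists_eq_erase {s t : Finset V} (hts : t ⊆ s) (hc : s.card = t.card + 1) :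
    ∃ v ∈ s, t = s.erase v := by
  have h : (s \ t).card = 1 := by rw [Finset.card_sdiff_of_subset hts]; omega
  obtain ⟨v, hv⟩ := Finset.card_eq_one.1 h
  have hv' : v ∈ s \ t := by simp [hv]
  refine ⟨v, (Finset.mem_sdiff.1 hv').1, ?_⟩
  rw [← Finset.sdiff_singleton_eq_erase, ← hv, Finset.sdiff_sdiff_eq_self hts]

open Classical in
theorem modTwoBoundary_single_apply (F : Set (Finset V)) (s t : Finset V) :
    modTwoBoundary F (Finsupp.single s 1) t =
      if t ∈ F ∧ t ⊆ s ∧ s.card = t.card + 1 then 1 else 0 := by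
  rw [modTwoBoundary_single, Finsupp.finsetSum_apply]
  split_ifs with h
  · obtain ⟨hF, hts, hc⟩ := h
    obtain ⟨v, hv, rfl⟩ := Finset.exists_eq_erase hts hc
    rw [Finset.sum_eq_single_of_mem v hv]
    · simp [hF]
    · intro w hw hwv
      have : s.erase w ≠ s.erase v := fun h => hwv (Finset.erase_injOn s hw hv h)
      rw [Finsupp.smul_apply, Finsupp.single_apply, if_neg this, smul_zero]
  · refine Finset.sum_eq_zero fun v hv => ?_
    by_cases hvt : s.erase v = t
    · subst hvt
      have : s.erase v ∉ F := fun hF =>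
        h ⟨hF, Finset.erase_subset _ _, (Finset.card_erase_add_one hv).symm⟩
      simp [this]
    · rw [Finsupp.smul_apply, Finsupp.single_apply, if_neg hvt, smul_zero]

-- Turns statements about cycles and boundaries into parity counts of incidences.
open Classical in
theorem modTwoBoundary_sum_single_apply (F : Set (Finset V)) (S : Finset (Finset V))
    (t : Finset V) :
    modTwoBoundary F (∑ s ∈ S, Finsupp.single s 1) t =
      if t ∈ F then (({s ∈ S | t ⊆ s ∧ s.card = t.card + 1} : Finset (Finset V)).card : ZMod 2)
      else 0 := by
  rw [map_sum, Finsupp.finsetSum_apply]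
  simp only [modTwoBoundary_single_apply]
  split_ifs with h
  · simp [h, Finset.sum_boole]
  · simp [h]

theorem sum_single_apply (S : Finset (Finset V)) (t : Finset V) :
    (∑ s ∈ S, Finsupp.single s (1 : ZMod 2)) t = if t ∈ S then 1 else 0 := by
  simp [Finsupp.finsetSum_apply, Finsupp.single_apply]

theorem eq_sum_support_single (x : Finset V →₀ ZMod 2) :
    x = ∑ s ∈ x.support, Finsupp.single s 1 := by
  ext t
  rw [sum_single_apply]
  have : ∀ a : ZMod 2, a ≠ 0 → a = 1 := by decide
  split_ifs with h
  · exact this _ (Finsupp.mem_support_iff.1 h)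
  · exact Finsupp.notMem_support_iff.1 h

theorem sum_single_mem_modTwoChains {V : Type*} {F : Set (Finset V)} {S : Finset (Finset V)} {n : ℕ}
    (hS : ∀ s ∈ S, s ∈ F ∧ s.card = n) :
    ∑ s ∈ S, Finsupp.single s 1 ∈ modTwoChains F n :=
  Submodule.sum_mem _ fun s hs => Finsupp.single_mem_supported _ _ (hS s hs)

/-! ### Codimension-two faces via ordered deletions -/

theorem Finset.erase_erase_eq_iff {s : Finset V} {a b v w : V} (ha : a ∈ s) (hb : b ∈ s)
    (hv : v ∈ s) (hw : w ∈ s) (hab : a ≠ b) (hvw : v ≠ w) :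
    (s.erase v).erase w = (s.erase a).erase b ↔ (v = a ∧ w = b) ∨ (v = b ∧ w = a) := by
  constructor
  · intro h
    have h1 := Finset.ext_iff.1 h v
    have h2 := Finset.ext_iff.1 h w
    simp only [Finset.mem_erase] at h1 h2
    grind
  · rintro (⟨rfl, rfl⟩ | ⟨rfl, rfl⟩)
    · rfl
    · exact Finset.erase_right_comm

/-- The sum of the faces of codimension two, with coefficients in terms of ordered pairs of
deleted vertices. -/
noncomputable def codimTwoSum (s : Finset V) (g : V → V → ZMod 2) : Finset V →₀ ZMod 2 :=
  ∑ v ∈ s, ∑ w ∈ s.erase v, g v w • Finsupp.single ((s.erase v).erase w) 1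

/-- Exactly two ordered deletions lead to a given codimension-two face, so only the symmetrization
of `g` matters. -/
theorem codimTwoSum_apply {s : Finset V} (g : V → V → ZMod 2) {a b : V} (ha : a ∈ s)
    (hb : b ∈ s) (hab : a ≠ b) :
    codimTwoSum s g ((s.erase a).erase b) = g a b + g b a := by
  have key : ∀ v ∈ s, ∀ w ∈ s.erase v,
      (g v w • Finsupp.single ((s.erase v).erase w) (1 : ZMod 2)) ((s.erase a).erase b) =
        (if v = a then if w = b then g a b else 0 else 0) +
          (if v = b then if w = a then g b a else 0 else 0) := by
    intro v hv w hw
    obtain ⟨hwv, hw⟩ := Finset.mem_erase.1 hw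
    have := Finset.erase_erase_eq_iff ha hb hv hw hab hwv.symm
    simp only [Finsupp.smul_apply, Finsupp.single_apply, this, smul_eq_mul]
    grind
  rw [codimTwoSum, Finsupp.finsetSum_apply]
  simp only [Finsupp.finsetSum_apply]
  rw [Finset.sum_congr rfl fun v hv => Finset.sum_congr rfl fun w hw => key v hv w hw]
  simp only [Finset.sum_add_distrib]
  congr 1
  · rw [Finset.sum_eq_single_of_mem a ha (by intro v _ h; simp [h])]
    simp [hb, hab.symm]
  · rw [Finset.sum_eq_single_of_mem b hb (by intro v _ h; simp [h])]
    simp [ha, hab]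

theorem codimTwoSum_apply_of_forall_ne {s t : Finset V} (g : V → V → ZMod 2)
    (ht : ∀ a ∈ s, ∀ b ∈ s, a ≠ b → t ≠ (s.erase a).erase b) : codimTwoSum s g t = 0 := by
  rw [codimTwoSum, Finsupp.finsetSum_apply]
  refine Finset.sum_eq_zero fun v hv => ?_
  rw [Finsupp.finsetSum_apply]
  refine Finset.sum_eq_zero fun w hw => ?_
  obtain ⟨hwv, hw⟩ := Finset.mem_erase.1 hw
  simp [(ht v hv w hw hwv.symm).symm]

theorem codimTwoSum_add (s : Finset V) (g g' : V → V → ZMod 2) :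
    codimTwoSum s g + codimTwoSum s g' = codimTwoSum s fun v w => g v w + g' v w := by
  simp [codimTwoSum, add_smul, Finset.sum_add_distrib]

theorem codimTwoSum_eq_zero {s : Finset V} {g : V → V → ZMod 2}
    (h : ∀ a ∈ s, ∀ b ∈ s, a ≠ b → g a b + g b a = 0) : codimTwoSum s g = 0 := by
  ext t
  by_cases ht : ∃ a ∈ s, ∃ b ∈ s, a ≠ b ∧ t = (s.erase a).erase b
  · obtain ⟨a, ha, b, hb, hab, rfl⟩ := ht
    rw [codimTwoSum_apply g ha hb hab, h a ha b hb hab, Finsupp.zero_apply]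
  · push Not at ht
    exact codimTwoSum_apply_of_forall_ne g ht

theorem codimTwoSum_eq_sum_powersetCard {s : Finset V} {g : V → V → ZMod 2}
    (hs : 2 ≤ s.card) (h : ∀ a ∈ s, ∀ b ∈ s, a ≠ b → g a b + g b a = 1) :
    codimTwoSum s g = ∑ t ∈ s.powersetCard (s.card - 2), Finsupp.single t 1 := by
  ext t
  rw [sum_single_apply]
  by_cases ht : ∃ a ∈ s, ∃ b ∈ s, a ≠ b ∧ t = (s.erase a).erase b
  · obtain ⟨a, ha, b, hb, hab, rfl⟩ := ht
    rw [codimTwoSum_apply g ha hb hab, h a ha b hb hab, if_pos]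
    rw [Finset.mem_powersetCard, Finset.card_erase_of_mem (by simp [hb, hab.symm]),
      Finset.card_erase_of_mem ha]
    exact ⟨(Finset.erase_subset _ _).trans (Finset.erase_subset _ _), by omega⟩
  · push Not at ht
    rw [codimTwoSum_apply_of_forall_ne g ht, if_neg]
    intro hmem
    obtain ⟨hts, hc⟩ := Finset.mem_powersetCard.1 hmem
    have hc2 : (s \ t).card = 2 := by rw [Finset.card_sdiff_of_subset hts]; omega
    obtain ⟨a, b, hab, hst⟩ := Finset.card_eq_two.1 hc2
    have ha : a ∈ s \ t := by simp [hst]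
    have hb : b ∈ s \ t := by simp [hst]
    refine ht a (Finset.mem_sdiff.1 ha).1 b (Finset.mem_sdiff.1 hb).1 hab ?_
    rw [← Finset.sdiff_sdiff_eq_self hts, hst]
    ext x
    simp only [Finset.mem_sdiff, Finset.mem_insert, Finset.mem_singleton, Finset.mem_erase]
    tauto

/-! ### The homotopy given by faces of even rank -/

open Classical in
/-- The sum of those codimension-one faces of a set whose deleted vertex has an even number of
predecessors in the set, with respect to a relation `r`. -/
noncomputable def evenFaces (r : V → V → Prop) :
    (Finset V →₀ ZMod 2) →ₗ[ZMod 2] (Finset V →₀ ZMod 2) :=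
  Finsupp.linearCombination (ZMod 2) fun s : Finset V =>
    ∑ v ∈ s, (if Even ({u ∈ s | r u v} : Finset V).card then (1 : ZMod 2) else 0) •
      Finsupp.single (s.erase v) 1

open Classical in
theorem evenFaces_single (r : V → V → Prop) (s : Finset V) :
    evenFaces r (Finsupp.single s 1) =
      ∑ v ∈ s, (if Even ({u ∈ s | r u v} : Finset V).card then (1 : ZMod 2) else 0) •
        Finsupp.single (s.erase v) 1 := by
  rw [evenFaces, Finsupp.linearCombination_single, one_smul]

theorem evenFaces_mem_modTwoChains {F : Set (Finset V)} {n : ℕ}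
    (hF : ∀ s ∈ F, s.card = n + 1 → ∀ v ∈ s, s.erase v ∈ F) (r : V → V → Prop)
    {S : Finset (Finset V)} (hS : ∀ s ∈ S, s ∈ F ∧ s.card = n + 1) :
    evenFaces r (∑ s ∈ S, Finsupp.single s 1) ∈ modTwoChains F n := by
  rw [map_sum]
  refine Submodule.sum_mem _ fun s hs => ?_
  obtain ⟨hsF, hc⟩ := hS s hs
  rw [evenFaces_single]
  refine Submodule.sum_mem _ fun v hv => Submodule.smul_mem _ _ ?_
  exact Finsupp.single_mem_supported _ _
    ⟨hF s hsF hc v hv, by rw [Finset.card_erase_of_mem hv]; omega⟩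

/-- Modulo 2, the sum of all codimension-two faces is chain homotopic to zero by means of the
codimension-one faces of even rank. -/
theorem modTwoBoundary_evenFaces_add {F : Set (Finset V)} (r : V → V → Prop)
    [IsStrictTotalOrder V r] {s : Finset V} (hs : 2 ≤ s.card)
    (h₁ : ∀ v ∈ s, s.erase v ∈ F)
    (h₂ : ∀ v ∈ s, ∀ w ∈ s.erase v, (s.erase v).erase w ∈ F) :
    modTwoBoundary F (evenFaces r (Finsupp.single s 1)) +
        evenFaces r (modTwoBoundary F (Finsupp.single s 1)) =
      ∑ t ∈ s.powersetCard (s.card - 2), Finsupp.single t 1 := by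
  classical
  have e₁ : modTwoBoundary F (evenFaces r (Finsupp.single s 1)) = codimTwoSum s fun v _ =>
      if Even ({u ∈ s | r u v} : Finset V).card then (1 : ZMod 2) else 0 := by
    rw [evenFaces_single, map_sum, codimTwoSum]
    refine Finset.sum_congr rfl fun v hv => ?_
    rw [map_smul, modTwoBoundary_single, Finset.smul_sum]
    refine Finset.sum_congr rfl fun w hw => ?_
    rw [if_pos (h₂ v hv w hw), one_smul]
  have e₂ : evenFaces r (modTwoBoundary F (Finsupp.single s 1)) = codimTwoSum s fun v w =>
      if Even ({u ∈ s.erase v | r u w} : Finset V).card then (1 : ZMod 2) else 0 := by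
    rw [modTwoBoundary_single, map_sum, codimTwoSum]
    refine Finset.sum_congr rfl fun v hv => ?_
    rw [if_pos (h₁ v hv), one_smul, evenFaces_single]
  rw [e₁, e₂, codimTwoSum_add]
  refine codimTwoSum_eq_sum_powersetCard hs ?_
  -- Deleting the larger vertex keeps the rank of the smaller; deleting the smaller lowers the rank
  -- of the larger by one.
  have key : ∀ a ∈ s, ∀ b ∈ s, r a b →
      ({u ∈ s.erase b | r u a} : Finset V).card = ({u ∈ s | r u a} : Finset V).card ∧
      ({u ∈ s.erase a | r u b} : Finset V).card + 1 = ({u ∈ s | r u b} : Finset V).card := by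
    intro a ha b hb hab
    rw [Finset.filter_erase, Finset.filter_erase]
    have hba : ¬ r b a := fun h => irrefl a (trans_of r hab h)
    refine ⟨by rw [Finset.erase_eq_of_notMem (by simp [hba])], ?_⟩
    exact Finset.card_erase_add_one (by simp [ha, hab])
  -- The two contributions of `a` cancel; those of `b` come from consecutive ranks, exactly one of
  -- which is even.
  have key' : ∀ a ∈ s, ∀ b ∈ s, r a b →
      ((if Even ({u ∈ s | r u a} : Finset V).card then (1 : ZMod 2) else 0) +
        if Even ({u ∈ s.erase a | r u b} : Finset V).card then (1 : ZMod 2) else 0) +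
      ((if Even ({u ∈ s | r u b} : Finset V).card then (1 : ZMod 2) else 0) +
        if Even ({u ∈ s.erase b | r u a} : Finset V).card then (1 : ZMod 2) else 0) = 1 := by
    intro a ha b hb hab
    obtain ⟨k₁, k₂⟩ := key a ha b hb hab
    rw [k₁, ← k₂]
    simp only [Nat.even_add_one]
    split_ifs <;> decide
  intro a ha b hb hab
  rcases trichotomous_of r a b with h | h | h
  · exact key' a ha b hb h
  · exact absurd h hab
  · rw [add_comm]
    exact key' b hb a ha h

/-- The two orders of deletion cancel. The hypothesis prevents a codimension-two face in `F` from
losing one of its two intermediate faces. -/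
theorem modTwoBoundary_modTwoBoundary_single {F : Set (Finset V)} {s : Finset V}
    (h : ∀ v ∈ s, ∀ w ∈ s.erase v, (s.erase v).erase w ∈ F → s.erase v ∈ F) :
    modTwoBoundary F (modTwoBoundary F (Finsupp.single s 1)) = 0 := by
  classical
  have e : modTwoBoundary F (modTwoBoundary F (Finsupp.single s 1)) = codimTwoSum s fun v w =>
      if (s.erase v).erase w ∈ F then (1 : ZMod 2) else 0 := by
    rw [modTwoBoundary_single, map_sum, codimTwoSum]
    refine Finset.sum_congr rfl fun v hv => ?_
    rw [map_smul, modTwoBoundary_single, Finset.smul_sum]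
    refine Finset.sum_congr rfl fun w hw => ?_
    by_cases hF : (s.erase v).erase w ∈ F
    · simp [hF, h v hv w hw hF]
    · simp [hF]
  rw [e]
  refine codimTwoSum_eq_zero fun a _ b _ _ => ?_
  rw [Finset.erase_right_comm]
  exact CharTwo.add_self_eq_zero _

end Boundary

namespace PreAbstractSimplicialComplex

variable {V : Type*}

/-! ### Faces, incidence numbers and links -/

theorem nonempty_of_mem {K : PreAbstractSimplicialComplex V} {s : Finset V}
    (hs : s ∈ K) : s.Nonempty :=
  (K.isRelLowerSet_faces hs).1

theorem mem_of_subset {K : PreAbstractSimplicialComplex V} {s t : Finset V}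
    (hs : s ∈ K) (hts : t ⊆ s) (ht : t.Nonempty) : t ∈ K :=
  (K.isRelLowerSet_faces hs).2 hts ht

theorem finite_simplices {K : PreAbstractSimplicialComplex V} (hK : K.faces.Finite) (k : ℕ) :
    (K.simplices k).Finite :=
  hK.subset fun _ hs => hs.1

theorem mem_simplices_oddSubcomplex {K : PreAbstractSimplicialComplex V} {d : ℕ} {s : Finset V} :
    s ∈ (K.oddSubcomplex d).simplices (d - 2) ↔
      s ∈ K.simplices (d - 2) ∧ Odd (K.incidence d s) := by
  constructor
  · rintro ⟨⟨_, t, ht, hodd, hst⟩, hc⟩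
    obtain rfl := Finset.eq_of_subset_of_card_le hst (by rw [ht.2, hc])
    exact ⟨ht, hodd⟩
  · rintro ⟨hs, hodd⟩
    exact ⟨⟨nonempty_of_mem hs.1, s, hs, hodd, subset_rfl⟩, hs.2⟩

theorem fundamentalChain_eq_sum {K : PreAbstractSimplicialComplex V} {k : ℕ}
    (hK : (K.simplices k).Finite) :
    K.fundamentalChain k = ∑ s ∈ hK.toFinset, Finsupp.single s 1 :=
  finsum_mem_eq_finite_toFinset_sum _ hK

variable [DecidableEq V]

theorem incidence_eq_card {K : PreAbstractSimplicialComplex V} {k : ℕ}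
    (hK : (K.simplices k).Finite) (t : Finset V) :
    K.incidence k t = ({s ∈ hK.toFinset | t ⊆ s} : Finset (Finset V)).card := by
  rw [incidence, ← Set.ncard_coe_finset]
  congr 1
  ext s
  simp

/-- Union with `s` is injective on the link and adds `s.card` to the dimension. -/
theorem incidence_link (K : PreAbstractSimplicialComplex V) {s t : Finset V} (hst : Disjoint s t)
    (k : ℕ) : (K.link s).incidence k t = K.incidence (k + s.card) (s ∪ t) := by
  have himg : {u | u ∈ K.simplices (k + s.card) ∧ s ∪ t ⊆ u} =
      (s ∪ ·) '' {u | u ∈ (K.link s).simplices k ∧ t ⊆ u} := by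
    ext u
    constructor
    · rintro ⟨⟨hu, hc⟩, hsub⟩
      have hsu : s ⊆ u := Finset.subset_union_left.trans hsub
      have hcard : (u \ s).card = k + 1 := by
        rw [Finset.card_sdiff_of_subset hsu]; omega
      have hun : s ∪ u \ s = u := Finset.union_sdiff_of_subset hsu
      refine ⟨u \ s, ⟨⟨⟨Finset.card_pos.1 (by omega), Finset.disjoint_sdiff, ?_⟩, hcard⟩, ?_⟩, hun⟩
      · rwa [hun]
      · exact Finset.subset_sdiff.2 ⟨Finset.subset_union_right.trans hsub, hst.symm⟩
    · rintro ⟨w, ⟨⟨⟨_, hd, hw⟩, hc⟩, htw⟩, rfl⟩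
      refine ⟨⟨hw, ?_⟩, Finset.union_subset_union_right htw⟩
      change (s ∪ w).card = _
      rw [Finset.card_union_of_disjoint hd]
      omega
  rw [incidence, incidence, himg, Set.InjOn.ncard_image]
  rintro u ⟨⟨⟨_, hu, _⟩, _⟩, _⟩ w ⟨⟨⟨_, hw, _⟩, _⟩, _⟩ h
  rw [← Finset.union_sdiff_cancel_left hu, ← Finset.union_sdiff_cancel_left hw]
  exact congrArg (· \ s) h

/-! ### The odd chain is a boundary -/

/-- If every `(d - 1)`-simplex lies in an even number of `d`-simplices, then the sum of the odd
`(d - 2)`-simplices is a boundary. -/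
theorem oddClassVanishes_of_even {K : PreAbstractSimplicialComplex V} {d : ℕ} (hd : 2 ≤ d)
    (hK : K.faces.Finite) (heven : ∀ r ∈ K.simplices (d - 1), Even (K.incidence d r)) :
    K.OddClassVanishes d := by
  classical
  obtain ⟨n, rfl⟩ : ∃ n, d = n + 2 := ⟨d - 2, by omega⟩
  have hS := finite_simplices hK (n + 2)
  have hO : (((K.oddSubcomplex (n + 2)).simplices n)).Finite :=
    (finite_simplices hK n).subset fun s hs => (mem_simplices_oddSubcomplex.1 hs).1
  set S := hS.toFinset
  have hSm : ∀ s ∈ S, s ∈ K ∧ s.card = n + 3 := fun s hs => hS.mem_toFinset.1 hs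
  set z : Finset V →₀ ZMod 2 := ∑ s ∈ S, Finsupp.single s 1 with hz
  have herase : ∀ s ∈ K, 2 ≤ s.card → ∀ v ∈ s, s.erase v ∈ K.faces := fun s hs hc v hv =>
    mem_of_subset hs (Finset.erase_subset _ _)
      (Finset.card_pos.1 (by rw [Finset.card_erase_of_mem hv]; omega))
  have hcycle : modTwoBoundary K.faces z = 0 := by
    ext t
    rw [modTwoBoundary_sum_single_apply, Finsupp.zero_apply]
    split_ifs with ht
    · by_cases hc : t.card = n + 2
      · rw [ZMod.natCast_eq_zero_iff_even]
        have := heven t ⟨ht, by omega⟩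
        rw [incidence_eq_card hS] at this
        convert this using 2
        refine Finset.filter_congr fun s hs => ?_
        have := (hSm s hs).2
        exact ⟨fun h => h.1, fun h => ⟨h, by omega⟩⟩
      · rw [Finset.filter_false_of_mem, Finset.card_empty, Nat.cast_zero]
        rintro s hs ⟨_, h⟩
        have := (hSm s hs).2
        omega
    · rfl
  -- Any strict total order on the vertices would do.
  set c := evenFaces (WellOrderingRel (α := V)) z with hc
  have hodd : (K.oddSubcomplex (n + 2)).fundamentalChain n = modTwoBoundary K.faces c := by
    have h := calc
      modTwoBoundary K.faces c = modTwoBoundary K.faces c +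
          evenFaces WellOrderingRel (modTwoBoundary K.faces z) := by simp [hcycle]
      _ = ∑ s ∈ S, ∑ t ∈ s.powersetCard (n + 1), Finsupp.single t 1 := by
        rw [hc, hz, map_sum, map_sum, map_sum, map_sum, ← Finset.sum_add_distrib]
        refine Finset.sum_congr rfl fun s hs => ?_
        obtain ⟨hsK, hsc⟩ := hSm s hs
        have h₁ : ∀ v ∈ s, s.erase v ∈ K.faces := herase s hsK (by omega)
        rw [modTwoBoundary_evenFaces_add _ (by omega) h₁, hsc]
        · rfl
        · intro v hv w hw
          exact herase _ (h₁ v hv) (by rw [Finset.card_erase_of_mem hv]; omega) w hw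
    rw [h, fundamentalChain_eq_sum hO]
    ext t
    rw [sum_single_apply, Finsupp.finsetSum_apply]
    simp only [sum_single_apply, Finset.mem_powersetCard, Finset.sum_boole]
    have hmem : t ∈ hO.toFinset ↔ (t ∈ K ∧ t.card = n + 1) ∧
        Odd ({s ∈ S | t ⊆ s} : Finset (Finset V)).card := by
      rw [hO.mem_toFinset, ← incidence_eq_card hS]
      exact mem_simplices_oddSubcomplex
    simp only [hmem]
    by_cases ht : t.card = n + 1
    · simp only [ht, and_true]
      split_ifs with hif
      · exact (ZMod.natCast_eq_one_iff_odd.2 hif.2).symm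
      · rw [eq_comm, ZMod.natCast_eq_zero_iff_even]
        -- An odd count is positive, so `t` is a face of some `d`-simplex and automatically belongs
        -- to `K`.
        by_contra hne
        rw [Nat.not_even_iff_odd] at hne
        obtain ⟨s, hs⟩ := Finset.card_pos.1 hne.pos
        obtain ⟨hs, hts⟩ := Finset.mem_filter.1 hs
        have htK : t ∈ K := mem_of_subset (hSm s hs).1 hts (Finset.card_pos.1 (by omega))
        exact hif ⟨htK, hne⟩
    · rw [if_neg fun h => ht h.1.2]
      simp [ht]
  have hcmem : c ∈ modTwoChains K.faces (n + 2) :=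
    evenFaces_mem_modTwoChains (fun s hs hsc => herase s hs (by omega)) _ hSm
  -- Simplices of `c` have `n + 2 ≥ 2` vertices, so their facets are nonempty and lie in `K`, even
  -- though `∅` does not.
  have hbdry : modTwoBoundary K.faces (modTwoBoundary K.faces c) = 0 := by
    rw [eq_sum_support_single c, map_sum, map_sum]
    refine Finset.sum_eq_zero fun s hs => ?_
    obtain ⟨hsK, hsc⟩ := (Finsupp.mem_supported _ _).1 hcmem hs
    exact modTwoBoundary_modTwoBoundary_single fun v hv _ _ _ => herase s hsK (by omega) v hv
  have hchain : (K.oddSubcomplex (n + 2)).fundamentalChain n ∈ modTwoChains K.faces (n + 1) := by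
    rw [fundamentalChain_eq_sum hO]
    exact sum_single_mem_modTwoChains fun s hs =>
      (mem_simplices_oddSubcomplex.1 (hO.mem_toFinset.1 hs)).1
  refine ⟨⟨hchain, ?_⟩, ?_⟩
  · change modTwoBoundary K.faces ((K.oddSubcomplex (n + 2)).fundamentalChain n) = 0
    rw [hodd, hbdry]
  · exact (Submodule.Quotient.mk_eq_zero _).2 ⟨c, hcmem, hodd.symm⟩

/-! ### Parity by double counting -/

theorem sum_incidence_eq {K : PreAbstractSimplicialComplex V} (hK : K.faces.Finite) (k l : ℕ) :
    ∑ t ∈ (finite_simplices hK k).toFinset, K.incidence l t =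
      (K.simplices l).ncard * (l + 1).choose (k + 1) := by
  have hl := finite_simplices hK l
  have hk := finite_simplices hK k
  have h := Finset.sum_card_bipartiteAbove_eq_sum_card_bipartiteBelow
    (s := hk.toFinset) (t := hl.toFinset) (· ⊆ ·)
  simp only [Finset.bipartiteAbove, Finset.bipartiteBelow] at h
  simp only [incidence_eq_card hl]
  rw [h, Set.ncard_eq_toFinset_card _ hl, ← smul_eq_mul]
  refine Finset.sum_const_nat fun s hs => ?_
  obtain ⟨hs, hsc⟩ := hl.mem_toFinset.1 hs
  rw [← hsc, ← Finset.card_powersetCard]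
  congr 1
  ext t
  rw [Finset.mem_filter, Finset.mem_powersetCard, hk.mem_toFinset]
  constructor
  · rintro ⟨⟨_, hc⟩, hts⟩
    exact ⟨hts, hc⟩
  · rintro ⟨hts, hc⟩
    exact ⟨⟨mem_of_subset hs hts (Finset.card_pos.1 (by omega)), hc⟩, hts⟩

theorem ncard_oddSubcomplex_modEq {K : PreAbstractSimplicialComplex V} {d : ℕ} (hd : 2 ≤ d)
    (hK : K.faces.Finite) :
    ((K.oddSubcomplex d).simplices (d - 2)).ncard ≡
      (K.simplices d).ncard * (d + 1).choose 2 [MOD 2] := by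
  have hk := finite_simplices hK (d - 2)
  have hsymm : (d + 1).choose 2 = (d + 1).choose (d - 2 + 1) :=
    (Nat.choose_symm_of_eq_add (by omega)).symm
  rw [hsymm, ← sum_incidence_eq hK]
  have hset : (K.oddSubcomplex d).simplices (d - 2) =
      ({s ∈ hk.toFinset | Odd (K.incidence d s)} : Finset (Finset V)) := by
    ext s
    rw [mem_simplices_oddSubcomplex]
    simp
  rw [hset, Set.ncard_coe_finset, ← ZMod.natCast_eq_natCast_iff, Nat.cast_sum,
    Finset.card_filter, Nat.cast_sum]
  refine Finset.sum_congr rfl fun s _ => ?_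
  split_ifs with h
  · simpa using (ZMod.natCast_eq_one_iff_odd.2 h).symm
  · simpa using ((ZMod.natCast_eq_zero_iff_even).2 (Nat.not_odd_iff_even.1 h)).symm

/-! ### Homology 0-spheres and facets of manifolds -/

theorem modTwoBoundaries_eq_bot {F : Set (Finset V)} {n : ℕ} (hF : ∀ s ∈ F, s.card ≤ n) :
    modTwoBoundaries F n = ⊥ := by
  have : modTwoChains F (n + 1) = ⊥ := by
    rw [modTwoChains, ← Finsupp.supported_empty]
    congr 1
    refine Set.eq_empty_of_forall_notMem fun s ⟨hs, hc⟩ => ?_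
    have := hF s hs
    omega
  rw [modTwoBoundaries, this, Submodule.map_bot]

/-- A complex of dimension zero with the mod 2 homology of the 0-sphere has two vertices. -/
theorem ncard_simplices_zero_of_sphere {K : PreAbstractSimplicialComplex V}
    (hK : ∀ s ∈ K, s.card ≤ 1) (hH : Nonempty (K.ReducedHomology 1 ≃ₗ[ZMod 2] ZMod 2)) :
    (K.simplices 0).ncard = 2 := by
  classical
  obtain ⟨φ⟩ := hH
  set F : Set (Finset V) := insert ∅ K.faces
  have hbd : modTwoBoundaries F 1 = ⊥ := modTwoBoundaries_eq_bot fun s hs => by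
    rcases hs with rfl | hs
    · simp
    · exact hK s hs
  -- The only condition is the augmentation: the boundary coefficient at `∅` is the number of
  -- vertices mod 2.
  have hcyc : ∀ S : Finset (Finset V), (∀ s ∈ S, s ∈ K.simplices 0) → Even S.card →
      ∑ s ∈ S, Finsupp.single s 1 ∈ modTwoCycles F 1 := by
    intro S hS heven
    refine ⟨sum_single_mem_modTwoChains fun s hs => ⟨Or.inr (hS s hs).1, (hS s hs).2⟩, ?_⟩
    change modTwoBoundary F _ = 0
    ext t
    rw [modTwoBoundary_sum_single_apply, Finsupp.zero_apply]
    split_ifs with ht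
    · rw [ZMod.natCast_eq_zero_iff_even]
      by_cases h0 : t = ∅
      · subst h0
        rwa [Finset.filter_true_of_mem]
        exact fun s hs => ⟨Finset.empty_subset _, (hS s hs).2⟩
      · rw [Finset.filter_false_of_mem]
        · simp
        · rintro s hs ⟨_, h⟩
          have := (hS s hs).2
          exact h0 (Finset.card_eq_zero.1 (by omega))
    · rfl
  -- Without boundaries, cycles embed in `ℤ/2`, which has a single nonzero element.
  have hinj : ∀ x y : modTwoCycles F 1, x ≠ 0 → y ≠ 0 → x = y := by
    have hker : ∀ x : modTwoCycles F 1, φ (Submodule.Quotient.mk x) = 0 → x = 0 := by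
      intro x hx
      have h := (Submodule.Quotient.mk_eq_zero _).1 (φ.map_eq_zero_iff.1 hx)
      have h' : (x : Finset V →₀ ZMod 2) ∈ modTwoBoundaries F 1 := h
      rw [hbd, Submodule.mem_bot] at h'
      exact Subtype.ext h'
    have h2 : ∀ a b : ZMod 2, a ≠ 0 → b ≠ 0 → a - b = 0 := by decide
    intro x y hx hy
    refine sub_eq_zero.1 (hker _ ?_)
    rw [Submodule.Quotient.mk_sub, map_sub]
    exact h2 _ _ (fun h => hx (hker _ h)) (fun h => hy (hker _ h))
  have hex : ∃ x : modTwoCycles F 1, x ≠ 0 := by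
    obtain ⟨x, hx⟩ := Submodule.Quotient.mk_surjective _ (φ.symm 1)
    refine ⟨x, ?_⟩
    rintro rfl
    rw [Submodule.Quotient.mk_zero] at hx
    exact one_ne_zero (φ.symm.map_eq_zero_iff.1 hx.symm)
  obtain ⟨⟨x, hxc, hxb⟩, hx0⟩ := hex
  have hx0' : x ≠ 0 := fun h => hx0 (Subtype.ext h)
  have hxsupp : ∀ s ∈ x.support, s ∈ K.simplices 0 := by
    intro s hs
    obtain ⟨h, hc⟩ := (Finsupp.mem_supported _ _).1 hxc hs
    rcases h with rfl | h
    · simp at hc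
    · exact ⟨h, hc⟩
  have hxsum : x = ∑ s ∈ x.support, Finsupp.single s 1 := eq_sum_support_single x
  have hxeven : Even x.support.card := by
    have h : modTwoBoundary F x ∅ = 0 := by
      rw [show modTwoBoundary F x = 0 from hxb, Finsupp.zero_apply]
    rw [hxsum, modTwoBoundary_sum_single_apply, if_pos (Set.mem_insert _ _),
      ZMod.natCast_eq_zero_iff_even, Finset.filter_true_of_mem] at h
    · exact h
    · exact fun s hs => ⟨Finset.empty_subset _, (hxsupp s hs).2⟩
  obtain ⟨a, ha⟩ := Finsupp.support_nonempty_iff.2 hx0'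
  have hcard : 1 < x.support.card := by
    have := Finset.card_pos.2 ⟨a, ha⟩
    obtain ⟨k, hk⟩ := hxeven
    omega
  obtain ⟨b, hb, hba⟩ := Finset.exists_mem_ne hcard a
  have hpair : ∀ y, y ∈ K.simplices 0 → y ≠ a → ∃ z : modTwoCycles F 1, z ≠ 0 ∧
      ∀ t, (z : Finset V →₀ ZMod 2) t = if t = a ∨ t = y then 1 else 0 := by
    intro y hy hya
    refine ⟨⟨_, hcyc {a, y} ?_ ?_⟩, ?_, ?_⟩
    · intro s hs
      rcases Finset.mem_insert.1 hs with rfl | hs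
      · exact hxsupp _ ha
      · rwa [Finset.mem_singleton.1 hs]
    · rw [Finset.card_pair hya.symm]
      exact even_two
    · intro h
      have := congrArg (fun z : modTwoCycles F 1 => (z : Finset V →₀ ZMod 2) a) h
      simp only [sum_single_apply] at this
      simp at this
    · intro t
      simp only [sum_single_apply, Finset.mem_insert, Finset.mem_singleton]
  have hset : K.simplices 0 = {a, b} := by
    ext y
    constructor
    · intro hy
      by_cases hya : y = a
      · exact Or.inl hya
      -- The nonzero cycles `a + b` and `a + y` coincide; comparing coefficients at `y` forces `y =
      -- b`.
      obtain ⟨z, hz0, hz⟩ := hpair b (hxsupp b hb) hba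
      obtain ⟨w, hw0, hw⟩ := hpair y hy hya
      have h := hz y
      rw [hinj z w hz0 hw0, hw] at h
      simp only [or_true, if_true] at h
      by_contra hne
      rw [if_neg (show ¬(y = a ∨ y = b) from hne)] at h
      exact one_ne_zero h
    · rintro (rfl | rfl)
      · exact hxsupp _ ha
      · exact hxsupp _ hb
  rw [hset, Set.ncard_pair hba.symm]

/-- The link of a `(d-1)`-simplex is a homology 0-sphere of dimension zero, and its vertices
correspond to the `d`-simplices around it. -/
theorem IsHomologyManifold.incidence_eq_two {K : PreAbstractSimplicialComplex V} {d : ℕ}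
    (hK : K.IsHomologyManifold d) {s : Finset V} (hs : s ∈ K) (hc : s.card = d) :
    K.incidence d s = 2 := by
  have h := incidence_link K (Finset.disjoint_empty_right s) 0
  rw [zero_add, hc, Finset.union_empty] at h
  have hsphere := hK.link_sphere s hs
  rw [hc, Nat.add_sub_cancel_left] at hsphere
  rw [← h, ← ncard_simplices_zero_of_sphere (K := K.link s) ?_ hsphere.1]
  · simp [incidence]
  · rintro t ⟨_, hd, ht⟩
    have := hK.card_le _ ht
    rw [Finset.card_union_of_disjoint hd] at this
    omega

/-! ### Two odd vertices in a link of dimension two -/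

theorem odd_vertices_not_adjacent {K : PreAbstractSimplicialComplex V} (hK : K.faces.Finite)
    (hH : Subsingleton (K.ReducedHomology 2)) (htwo : ∀ e ∈ K.simplices 1, K.incidence 2 e = 2)
    {a b : V} (hab : a ≠ b)
    (hodd : ∀ v, {v} ∈ K → (Odd (K.incidence 2 {v}) ↔ v = a ∨ v = b)) : {a, b} ∉ K := by
  classical
  intro he₀
  set e₀ : Finset V := {a, b} with he₀_def
  set F : Set (Finset V) := insert ∅ K.faces
  have hE := finite_simplices hK 1
  have hT := finite_simplices hK 2
  set E := hE.toFinset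
  set T := hT.toFinset with hT_def
  have hEm : ∀ e, e ∈ E ↔ e ∈ K ∧ e.card = 2 := fun e => hE.mem_toFinset
  have hTm : ∀ e, e ∈ T ↔ e ∈ K ∧ e.card = 3 := fun e => hT.mem_toFinset
  have he₀E : e₀ ∈ E := (hEm _).2 ⟨he₀, Finset.card_pair hab⟩
  have htwo' : ∀ e ∈ E, ({t ∈ T | e ⊆ t} : Finset (Finset V)).card = 2 := fun e he => by
    rw [← incidence_eq_card hT]
    exact htwo e ((hEm e).1 he)
  -- Count pairs `v ∈ e ⊆ t`: each edge at `v` lies in two triangles, and each triangle at `v` has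
  -- two edges at `v`.
  have hvert : ∀ v, ({e ∈ E | {v} ⊆ e} : Finset (Finset V)).card =
      ({t ∈ T | {v} ⊆ t} : Finset (Finset V)).card := by
    intro v
    have h := Finset.sum_card_bipartiteAbove_eq_sum_card_bipartiteBelow
      (s := {e ∈ E | {v} ⊆ e}) (t := {t ∈ T | {v} ⊆ t}) (· ⊆ ·)
    rw [Finset.sum_const_nat (m := 2), Finset.sum_const_nat (m := 2)] at h
    · omega
    · intro t ht
      obtain ⟨ht, hvt⟩ := Finset.mem_filter.1 ht
      obtain ⟨htK, htc⟩ := (hTm t).1 ht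
      have hvt' : v ∈ t := Finset.singleton_subset_iff.1 hvt
      have himg : Finset.bipartiteBelow (· ⊆ ·) {e ∈ E | {v} ⊆ e} t =
          (t.erase v).image fun w => t.erase w := by
        ext e
        simp only [Finset.bipartiteBelow, Finset.mem_filter, Finset.mem_image]
        constructor
        · rintro ⟨⟨heE, hve⟩, het⟩
          obtain ⟨w, hw, rfl⟩ := Finset.exists_eq_erase het (by rw [htc, ((hEm e).1 heE).2])
          refine ⟨w, Finset.mem_erase.2 ⟨?_, hw⟩, rfl⟩
          rintro rfl
          simp at hve
        · rintro ⟨w, hw, rfl⟩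
          obtain ⟨hwv, hw⟩ := Finset.mem_erase.1 hw
          have hve : v ∈ t.erase w := Finset.mem_erase.2 ⟨hwv.symm, hvt'⟩
          exact ⟨⟨(hEm _).2 ⟨mem_of_subset htK (Finset.erase_subset _ _) ⟨v, hve⟩,
            by rw [Finset.card_erase_of_mem hw, htc]⟩, Finset.singleton_subset_iff.2 hve⟩,
            Finset.erase_subset _ _⟩
      rw [himg, Finset.card_image_of_injOn, Finset.card_erase_of_mem hvt', htc]
      exact (Finset.erase_injOn t).mono (Finset.erase_subset _ _)
    · intro e he
      obtain ⟨he, hve⟩ := Finset.mem_filter.1 he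
      rw [← htwo' e he, Finset.bipartiteAbove, Finset.filter_filter]
      congr 1
      exact Finset.filter_congr fun t _ => ⟨fun h => h.2, fun h => ⟨hve.trans h, h⟩⟩
  -- Only `a` and `b` have odd edge degree, and removing the edge `ab` makes both even.
  have hcyc : ∑ e ∈ E.erase e₀, Finsupp.single e 1 ∈ modTwoCycles F 2 := by
    refine ⟨sum_single_mem_modTwoChains fun e he => ?_, ?_⟩
    · obtain ⟨h, hc⟩ := (hEm e).1 (Finset.mem_of_mem_erase he)
      exact ⟨Or.inr h, hc⟩
    change modTwoBoundary F _ = 0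
    ext t
    rw [modTwoBoundary_sum_single_apply, Finsupp.zero_apply]
    split_ifs with ht
    · rw [ZMod.natCast_eq_zero_iff_even]
      by_cases hc : t.card = 1
      · obtain ⟨v, rfl⟩ := Finset.card_eq_one.1 hc
        have hvK : {v} ∈ K := by
          rcases ht with ht | ht
          · simp at ht
          · exact ht
        have hfil : ({e ∈ E.erase e₀ | {v} ⊆ e ∧ e.card = ({v} : Finset V).card + 1} :
            Finset (Finset V)) = ({e ∈ E | {v} ⊆ e} : Finset (Finset V)).erase e₀ := by
          rw [← Finset.filter_erase]
          refine Finset.filter_congr fun e he => ?_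
          have := ((hEm e).1 (Finset.mem_of_mem_erase he)).2
          rw [Finset.card_singleton]
          exact ⟨fun h => h.1, fun h => ⟨h, this⟩⟩
        have ho := hodd v hvK
        rw [incidence_eq_card hT, ← hT_def, ← hvert v] at ho
        rw [hfil]
        by_cases hv : v = a ∨ v = b
        · have hmem : e₀ ∈ ({e ∈ E | {v} ⊆ e} : Finset (Finset V)) :=
            Finset.mem_filter.2 ⟨he₀E, by simpa [he₀_def] using hv⟩
          have h := ho.2 hv
          rw [← Finset.card_erase_add_one hmem, Nat.odd_add_one, Nat.not_odd_iff_even] at h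
          exact h
        · rw [Finset.erase_eq_of_notMem, ← Nat.not_odd_iff_even, ho]
          · exact hv
          · intro h
            exact hv (by simpa [he₀_def] using (Finset.mem_filter.1 h).2)
      · rw [Finset.filter_false_of_mem]
        · simp
        · rintro e he ⟨_, h⟩
          have := ((hEm e).1 (Finset.mem_of_mem_erase he)).2
          omega
    · rfl
  obtain ⟨f, hf, hfb⟩ : ∑ e ∈ E.erase e₀, Finsupp.single e 1 ∈ modTwoBoundaries F 2 := by
    have h : (Submodule.Quotient.mk ⟨_, hcyc⟩ : K.ReducedHomology 2) = 0 := Subsingleton.elim _ _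
    have h' := (Submodule.Quotient.mk_eq_zero _).1 h
    exact h'
  set B := f.support
  have hBT : B ⊆ T := by
    intro t ht
    obtain ⟨h, hc⟩ := (Finsupp.mem_supported _ _).1 hf ht
    rcases h with rfl | h
    · simp at hc
    · exact (hTm t).2 ⟨h, hc⟩
  have hfsum : f = ∑ s ∈ B, Finsupp.single s 1 := eq_sum_support_single f
  have hpar : ∀ e ∈ E, (({t ∈ B | e ⊆ t} : Finset (Finset V)).card : ZMod 2) =
      if e = e₀ then 0 else 1 := by
    intro e he
    have h := congrArg (fun g => g e) hfb
    obtain ⟨heK, hec⟩ := (hEm e).1 he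
    beta_reduce at h
    rw [hfsum, modTwoBoundary_sum_single_apply, if_pos (show e ∈ F from Or.inr heK),
      sum_single_apply] at h
    have hfil : ({t ∈ B | e ⊆ t} : Finset (Finset V)) =
        {t ∈ B | e ⊆ t ∧ t.card = e.card + 1} := by
      refine Finset.filter_congr fun t ht => ?_
      have := ((hTm t).1 (hBT ht)).2
      exact ⟨fun h => ⟨h, by omega⟩, fun h => h.1⟩
    rw [hfil, h]
    by_cases h0 : e = e₀ <;> simp [h0, he]
  have hle : ∀ e ∈ E, ({t ∈ B | e ⊆ t} : Finset (Finset V)).card ≤ 2 := fun e he =>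
    (Finset.card_le_card (Finset.filter_subset_filter _ hBT)).trans (htwo' e he).le
  have hcount : ∀ A ⊆ T, ∑ e ∈ E, ({t ∈ A | e ⊆ t} : Finset (Finset V)).card = A.card * 3 := by
    intro A hA
    have h := Finset.sum_card_bipartiteAbove_eq_sum_card_bipartiteBelow
      (s := E) (t := A) (· ⊆ ·)
    simp only [Finset.bipartiteAbove, Finset.bipartiteBelow] at h
    rw [h]
    refine Finset.sum_const_nat fun t ht => ?_
    obtain ⟨htK, htc⟩ := (hTm t).1 (hA ht)
    have : ({e ∈ E | e ⊆ t} : Finset (Finset V)) = t.powersetCard 2 := by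
      ext e
      rw [Finset.mem_filter, hEm, Finset.mem_powersetCard]
      exact ⟨fun h => ⟨h.2, h.1.2⟩, fun h =>
        ⟨⟨mem_of_subset htK h.1 (Finset.card_pos.1 (by omega)), h.2⟩, h.1⟩⟩
    rw [this, Finset.card_powersetCard, htc]
    rfl
  -- An odd number that is at most 2.
  have hone : ∀ e ∈ E.erase e₀, ({t ∈ B | e ⊆ t} : Finset (Finset V)).card = 1 := by
    intro e he
    obtain ⟨hne, he⟩ := Finset.mem_erase.1 he
    have h := hpar e he
    rw [if_neg hne, ZMod.natCast_eq_one_iff_odd] at h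
    obtain ⟨k, hk⟩ := h
    have := hle e he
    omega
  -- Here `2|E| = 3|T|`, so 3 divides `|E|`. But `3|B| = |E| - 1 + ε`, where `ε`, the number of
  -- triangles of `B` on `e₀`, is 0 or 2, so `|E| ≡ ±1` mod 3.
  have h₁ := hcount T subset_rfl
  rw [Finset.sum_const_nat htwo'] at h₁
  have h₂ := hcount B hBT
  rw [← Finset.add_sum_erase _ _ he₀E, Finset.sum_const_nat hone,
    Finset.card_erase_of_mem he₀E] at h₂
  have h₃ := hpar e₀ he₀E
  rw [if_pos rfl, ZMod.natCast_eq_zero_iff_even] at h₃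
  obtain ⟨k, hk⟩ := h₃
  have h₄ := hle e₀ he₀E
  have h₅ := Finset.card_pos.2 ⟨_, he₀E⟩
  omega

/-- In the link of `τ`, the simplices `σ₁`, `σ₂` become vertices `a`, `b`, and a common
`(d-1)`-simplex would make `{a, b}` an edge. Incidence numbers are preserved by `incidence_link`. -/
theorem IsHomologyManifold.odd_not_adjacent {K : PreAbstractSimplicialComplex V} {d : ℕ}
    (hd : 3 ≤ d) (hK : K.IsHomologyManifold d) {τ σ₁ σ₂ : Finset V} (hτ : τ ∈ K.simplices (d - 3))
    (hne : σ₁ ≠ σ₂)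
    (hodd : {σ | σ ∈ (K.oddSubcomplex d).simplices (d - 2) ∧ τ ⊆ σ} = {σ₁, σ₂}) :
    ¬ ∃ ρ ∈ K.simplices (d - 1), σ₁ ⊆ ρ ∧ σ₂ ⊆ ρ := by
  rintro ⟨ρ, ⟨hρ, hρc⟩, h₁ρ, h₂ρ⟩
  obtain ⟨hτK, hτc⟩ := hτ
  have hmem : ∀ σ, (σ ∈ K.simplices (d - 2) ∧ Odd (K.incidence d σ)) ∧ τ ⊆ σ ↔
      σ = σ₁ ∨ σ = σ₂ := fun σ => by
    rw [← mem_simplices_oddSubcomplex]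
    exact Set.ext_iff.1 hodd σ
  have hins : ∀ σ, σ = σ₁ ∨ σ = σ₂ → ∃ v ∉ τ, insert v τ = σ := by
    intro σ hσ
    obtain ⟨⟨⟨_, hc⟩, _⟩, hτσ⟩ := (hmem σ).2 hσ
    obtain ⟨v, hv, h⟩ := Finset.exists_eq_erase hτσ (by omega)
    exact ⟨v, by simp [h], by rw [h, Finset.insert_erase hv]⟩
  obtain ⟨a, ha, rfl⟩ := hins σ₁ (Or.inl rfl)
  obtain ⟨b, hb, rfl⟩ := hins σ₂ (Or.inr rfl)
  have hab : a ≠ b := fun h => hne (by rw [h])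
  have hunion : ∀ v, τ ∪ {v} = insert v τ := fun v => by
    rw [Finset.union_comm, ← Finset.insert_eq]
  have hsphere := hK.link_sphere τ hτK
  rw [show d + 1 - τ.card = 3 by omega] at hsphere
  -- The link has the homology of a 2-sphere (index 3), so index 2, which is degree 1, vanishes.
  refine odd_vertices_not_adjacent (K := K.link τ) ?_ (hsphere.2 2 (by omega)) ?_ hab ?_ ?_
  · refine Set.Finite.of_finite_image ((hK.locallyFinite τ hτK).subset ?_) (f := (τ ∪ ·)) ?_
    · rintro _ ⟨t, ⟨_, _, ht⟩, rfl⟩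
      exact ⟨ht, Finset.subset_union_left⟩
    · rintro u ⟨_, hu, _⟩ w ⟨_, hw, _⟩ h
      rw [← Finset.union_sdiff_cancel_left hu, ← Finset.union_sdiff_cancel_left hw]
      exact congrArg (· \ τ) h
  · rintro e ⟨⟨_, hd', he⟩, hec⟩
    rw [incidence_link K hd', show 2 + τ.card = d by omega]
    exact hK.incidence_eq_two he (by rw [Finset.card_union_of_disjoint hd']; omega)
  · rintro v ⟨_, hd', hv⟩
    rw [incidence_link K hd', show 2 + τ.card = d by omega]
    have hvτ : v ∉ τ := Finset.disjoint_singleton_right.1 hd'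
    rw [hunion] at hv ⊢
    have h := hmem (insert v τ)
    have hinj : ∀ w, insert v τ = insert w τ ↔ v = w := fun w =>
      ⟨fun h => (Finset.insert_inj hvτ).1 h, fun h => by rw [h]⟩
    rw [hinj, hinj] at h
    rw [← h]
    refine ⟨fun ho => ⟨⟨⟨hv, ?_⟩, ho⟩, Finset.subset_insert _ _⟩, fun h => h.1.2⟩
    rw [Finset.card_insert_of_notMem hvτ]
    omega
  · refine ⟨by simp, by simp [ha, hb], ?_⟩
    refine mem_of_subset hρ (Finset.union_subset ((Finset.subset_insert _ _).trans h₁ρ) ?_)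
      (by simp)
    rw [Finset.insert_subset_iff, Finset.singleton_subset_iff]
    exact ⟨h₁ρ (Finset.mem_insert_self _ _), h₂ρ (Finset.mem_insert_self _ _)⟩

end PreAbstractSimplicialComplex

/-! ### The theorem, with the parity of `(d+1).choose 2` by residue of `d` mod 4 -/

open PreAbstractSimplicialComplex in
theorem mainTheorem5 {V : Type*} [DecidableEq V] (K : PreAbstractSimplicialComplex V) (d : ℕ)
    (hd : 2 ≤ d) :
    -- (1) the odd subcomplex is a boundary mod 2, for closed triangulated manifolds and, more
    -- generally, for finite complexes whose `d`-simplices sum up to a mod 2 cycle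
    (K.faces.Finite → K.IsHomologyManifold d → K.OddClassVanishes d) ∧
    (K.faces.Finite → (∀ r ∈ K.simplices (d - 1), Even (K.incidence d r)) →
      K.OddClassVanishes d) ∧
    -- (2) parity of the number of `(d - 2)`-faces of the odd subcomplex
    (K.faces.Finite →
      (d % 4 = 0 ∨ d % 4 = 3 → Even ((K.oddSubcomplex d).simplices (d - 2)).ncard) ∧
      (d % 4 = 1 ∨ d % 4 = 2 →
        ((K.oddSubcomplex d).simplices (d - 2)).ncard ≡ (K.simplices d).ncard [MOD 2])) ∧
    -- (3) two odd faces that are the only ones around a `(d - 3)`-face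
    (3 ≤ d → K.IsHomologyManifold d →
      ∀ τ ∈ K.simplices (d - 3), ∀ σ₁ σ₂ : Finset V, σ₁ ≠ σ₂ →
        {σ | σ ∈ (K.oddSubcomplex d).simplices (d - 2) ∧ τ ⊆ σ} = {σ₁, σ₂} →
        ¬ ∃ ρ ∈ K.simplices (d - 1), σ₁ ⊆ ρ ∧ σ₂ ⊆ ρ) := by
  refine ⟨fun hfin hK => oddClassVanishes_of_even hd hfin fun r hr => ?_,
    oddClassVanishes_of_even hd, fun hfin => ⟨fun h => ?_, fun h => ?_⟩,
    fun h3 hK τ hτ σ₁ σ₂ hne hodd => hK.odd_not_adjacent h3 hτ hne hodd⟩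
  · rw [hK.incidence_eq_two hr.1 (by rw [hr.2]; omega)]
    exact even_two
  · have hpar := ncard_oddSubcomplex_modEq hd hfin
    have hc : Even ((d + 1).choose 2) := by
      rw [Nat.choose_two_right, Nat.add_sub_cancel, Nat.even_iff]
      obtain ⟨q, rfl | rfl⟩ : ∃ q, d = 4 * q ∨ d = 4 * q + 3 := ⟨d / 4, by omega⟩
      · rw [show (4 * q + 1) * (4 * q) = 2 * (2 * (q * (4 * q + 1))) by ring]
        omega
      · rw [show (4 * q + 3 + 1) * (4 * q + 3) = 2 * (2 * ((q + 1) * (4 * q + 3))) by ring]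
        omega
    rw [Nat.even_iff, hpar, ← Nat.even_iff]
    exact hc.mul_left _
  · refine (ncard_oddSubcomplex_modEq hd hfin).trans ?_
    have hc : (d + 1).choose 2 ≡ 1 [MOD 2] := by
      rw [Nat.choose_two_right, Nat.add_sub_cancel, Nat.ModEq]
      obtain ⟨q, rfl | rfl⟩ : ∃ q, d = 4 * q + 1 ∨ d = 4 * q + 2 := ⟨d / 4, by omega⟩
      · rw [show (4 * q + 1 + 1) * (4 * q + 1) = 2 * (2 * (q * (4 * q + 3)) + 1) by ring]
        omega
      · rw [show (4 * q + 2 + 1) * (4 * q + 2) = 2 * (2 * (q * (4 * q + 5) + 1) + 1) by ring]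
        omega
    simpa using hc.mul_left (K.simplices d).ncard
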